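/- Let $d\ge 2$ and let $G$ be the Weyl–Heisenberg group acting on $\mathbb{C}^d=\mathbb{C}^{\mathbb{Z}_d}$, i.e. the (finite) group of unitary maps generated by the shift $S e_j=e_{j+1}$ and the modulation $\Omega e_j=\omega^j e_j$, $\omega=e^{2\pi i/d}$, $j\in\mathbb{Z}_d$. For $z\in\mathbb{C}^d$ and $s,t\in\mathbb{Z}_d$ put $$f_{st}(z)=\sum_{r\in\mathbb{Z}_d} z_r\,\overline{z_{r+s}}\,\overline{z_{r+t}}\,z_{r+s+t}.$$ Let $H(p,q)$ be the space of polynomials in $z,\overline z$ that are homogeneous of degree $p$ in $z$ and $q$ in $\overline z$ and are annihilated by $\sum_j \partial_{z_j}\partial_{\overline z_j}$. A finite sequence $(x_k)_{k=1}^n$ of unit vectors in $\mathbb{C}^d$ is a spherical $(2,2)$-design if $\int_{\mathbb S} f\,d\sigma=\frac1n\sum_{k} f(x_k)$ for all $f\in H(0,0)\oplus H(1,1)\oplus H(2,2)$, where $\sigma$ is the normalised surface area measure on the unit sphere $\mathbb S$ of $\mathbb{C}^d$. The orbit $(gz)_{g\in G}$ of a unit vector $z$ is a (Weyl–Heisenberg)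 SIC if the set of lines $\{\mathbb{C}\,gz : g\in G\}$ has exactly $d^2$ elements and is equiangular, i.e. $|\langle u,v\rangle|$ is the same for all unit vectors $u,v$ spanning two different lines of the set. Let $z\in\mathbb{C}^d$ with $\|z\|=1$. Then: 1. the orbit $(gz)_{g\in G}$ is a SIC if and only if it is a spherical $(2,2)$-design; 2. the orbit $(gz)_{g\in G}$ is a spherical $(2,2)$-design if and only if $$f_{st}(z)=0\quad (s,t\ne 0),\qquad f_{00}(z)=2f_{s0}(z)\quad (s\ne 0);$$ 3. the conditions in 2 hold if and only if $$f_{st}(z)=0\quad (s,t\ne 0),\qquad f_{s0}(z)=\frac1{d+1}\quad (s\ne 0),\qquad f_{00}(z)=\frac2{d+1}.$$ -/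

import Mathlib

namespace WHDesign

open MeasureTheory MvPolynomial

/-! ### Complex spherical designs on the unit sphere of `ℂ^ι` -/

section Designs

variable {ι : Type*} [Fintype ι]

/-- The normalised surface area measure on the unit sphere of `ℂ^ι` (as a real Euclidean space). -/
noncomputable def surfaceMeasure (ι : Type*) [Fintype ι] :
    Measure (Metric.sphere (0 : EuclideanSpace ℂ ι) 1) :=
  ((volume : Measure (EuclideanSpace ℂ ι)).toSphere Set.univ)⁻¹ •
    (volume : Measure (EuclideanSpace ℂ ι)).toSphere

/-- A polynomial in `z` and `z̄`: the variable `Sum.inl j` stands for `z_j`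
and the variable `Sum.inr j` stands for the conjugate of `z_j`. -/
abbrev ZPoly (ι : Type*) : Type _ := MvPolynomial (ι ⊕ ι) ℂ

/-- The value at `z` of a polynomial in `z` and `z̄`. -/
noncomputable def evalZ (f : ZPoly ι) (z : EuclideanSpace ℂ ι) : ℂ :=
  MvPolynomial.eval (Sum.elim (fun j => z j) (fun j => star (z j))) f

/-- `Hom(p,q)`: the polynomials that are homogeneous of degree `p` in `z` and of degree `q`
in `z̄`. -/
noncomputable def homPoly (ι : Type*) (p q : ℕ) : Submodule ℂ (ZPoly ι) :=
  weightedHomogeneousSubmodule ℂ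
    (Sum.elim (fun _ : ι => ((1, 0) : ℕ × ℕ)) (fun _ : ι => ((0, 1) : ℕ × ℕ))) (p, q)

/-- The Laplacian `∑_j ∂²/∂z_j∂z̄_j`. -/
noncomputable def laplacian (ι : Type*) [Fintype ι] : ZPoly ι →ₗ[ℂ] ZPoly ι :=
  ∑ j : ι, (pderiv (R := ℂ) (Sum.inl j : ι ⊕ ι)).toLinearMap ∘ₗ
    (pderiv (R := ℂ) (Sum.inr j : ι ⊕ ι)).toLinearMap

/-- `H(p,q)`: the harmonic polynomials in `Hom(p,q)`. -/
noncomputable def harmPoly (ι : Type*) [Fintype ι] (p q : ℕ) : Submodule ℂ (ZPoly ι) :=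
  homPoly ι p q ⊓ LinearMap.ker (laplacian ι)

/-- `P_τ`, the sum of the spaces `H(p,q)` over `(p,q) ∈ τ`. -/
noncomputable def tauPoly (ι : Type*) [Fintype ι] (τ : Set (ℕ × ℕ)) : Submodule ℂ (ZPoly ι) :=
  ⨆ i ∈ τ, harmPoly ι i.1 i.2

/-- The finite sequence (or multiset) `X` of points is a spherical `τ`-design: the points are
unit vectors, and every polynomial in `P_τ` has the same average over the sphere and over `X`. -/
def IsTauDesign (τ : Set (ℕ × ℕ)) {κ : Type*} [Fintype κ] (X : κ → EuclideanSpace ℂ ι) : Prop :=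
  (∀ k, ‖X k‖ = 1) ∧
    ∀ f ∈ tauPoly ι τ,
      ∫ x, evalZ f (x : EuclideanSpace ℂ ι) ∂(surfaceMeasure ι) =
        (1 / (Fintype.card κ : ℂ)) * ∑ k, evalZ f (X k)

/-- A spherical `(t,t)`-design: it integrates the indices `(0,0), (1,1), …, (t,t)`. -/
def IsTTDesign (t : ℕ) {κ : Type*} [Fintype κ] (X : κ → EuclideanSpace ℂ ι) : Prop :=
  IsTauDesign {i : ℕ × ℕ | i.1 = i.2 ∧ i.1 ≤ t} X

/-- A set of lines is equiangular: the modulus of the inner product of unit vectors spanning two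
different lines is a constant. -/
def IsEquiangular (L : Set (Submodule ℂ (EuclideanSpace ℂ ι))) : Prop :=
  ∃ c : ℝ, ∀ ℓ ∈ L, ∀ ℓ' ∈ L, ℓ ≠ ℓ' → ∀ u ∈ ℓ, ∀ v ∈ ℓ', ‖u‖ = 1 → ‖v‖ = 1 →
    ‖inner ℂ u v‖ = c

end Designs

/-! ### The Weyl–Heisenberg group acting on `ℂ^d`, with coordinates indexed by `ZMod d` -/

section WeylHeisenberg

variable (d : ℕ) [NeZero d]

/-- `ℂ^d`, with coordinates indexed by the integers modulo `d`. -/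
abbrev CSpace : Type := EuclideanSpace ℂ (ZMod d)

/-- The shift operator `S e_j = e_{j+1}`. -/
noncomputable def shift : CSpace d ≃ₗᵢ[ℂ] CSpace d :=
  LinearIsometryEquiv.piLpCongrLeft 2 ℂ ℂ (Equiv.addRight (1 : ZMod d))

/-- The modulation operator `Ω e_j = ω^j e_j`, `ω = exp (2πi/d)`; here
`ZMod.stdAddChar j = exp (2πi j/d)`. -/
noncomputable def modulation : CSpace d ≃ₗᵢ[ℂ] CSpace d where
  toFun z := WithLp.toLp 2 fun j => ZMod.stdAddChar j * z j
  invFun z := WithLp.toLp 2 fun j => ZMod.stdAddChar (-j) * z j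
  map_add' x y := by ext j; simp [mul_add]
  map_smul' c x := by ext j; simp [mul_left_comm]
  left_inv x := by
    ext j
    simp only [← mul_assoc, ← AddChar.map_add_eq_mul, neg_add_cancel, AddChar.map_zero_eq_one,
      one_mul]
  right_inv x := by
    ext j
    simp only [← mul_assoc, ← AddChar.map_add_eq_mul, add_neg_cancel, AddChar.map_zero_eq_one,
      one_mul]
  norm_map' x := by
    simp [EuclideanSpace.norm_eq, ZMod.stdAddChar_apply, Circle.norm_coe]

/-- The Weyl–Heisenberg group: the group of unitary maps generated by `S` and `Ω`. -/
noncomputable def weylHeisenberg : Subgroup (CSpace d ≃ₗᵢ[ℂ] CSpace d) :=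
  Subgroup.closure {shift d, modulation d}

lemma shift_single (j : ZMod d) (a : ℂ) :
    shift d (EuclideanSpace.single j a) = EuclideanSpace.single (j + 1) a :=
  LinearIsometryEquiv.piLpCongrLeft_single (p := 2) (𝕜 := ℂ) _ j a

lemma shift_apply (z : CSpace d) (i : ZMod d) : shift d z i = z (i - 1) := by
  simp [shift, LinearIsometryEquiv.piLpCongrLeft_apply, Equiv.piCongrLeft', sub_eq_add_neg]

lemma modulation_apply (z : CSpace d) (i : ZMod d) :
    modulation d z i = ZMod.stdAddChar i * z i := rfl

lemma exists_of_mem_weylHeisenberg {g : CSpace d ≃ₗᵢ[ℂ] CSpace d} (hg : g ∈ weylHeisenberg d) :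
    ∃ l j k : ZMod d, ∀ (z : CSpace d) (i : ZMod d),
      g z i = ZMod.stdAddChar (l + k * i) * z (i - j) := by
  induction hg using Subgroup.closure_induction with
  | mem x hx =>
    rcases hx with rfl | rfl
    · exact ⟨0, 1, 0, fun z i => by simp [shift_apply]⟩
    · exact ⟨0, 0, 1, fun z i => by simp [modulation_apply]⟩
  | one => exact ⟨0, 0, 0, fun z i => by simp⟩
  | mul x y _ _ hx hy =>
    obtain ⟨l, j, k, h⟩ := hx
    obtain ⟨l', j', k', h'⟩ := hy
    refine ⟨l + l' - k' * j, j + j', k + k', fun z i => ?_⟩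
    change x (y z) i = _
    rw [h, h', ← mul_assoc, ← AddChar.map_add_eq_mul]
    rw [show l + k * i + (l' + k' * (i - j)) = l + l' - k' * j + (k + k') * i by ring,
      sub_sub]
  | inv x _ hx =>
    obtain ⟨l, j, k, h⟩ := hx
    refine ⟨-l - k * j, -j, -k, fun z i => ?_⟩
    have h1 := h (x⁻¹ z) (i + j)
    have h2 : x (x⁻¹ z) = z := x.apply_symm_apply z
    rw [h2, add_sub_cancel_right] at h1
    rw [sub_neg_eq_add, h1, ← mul_assoc, ← AddChar.map_add_eq_mul]
    rw [show -l - k * j + -k * i + (l + k * (i + j)) = 0 by ring]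
    simp

instance : Finite (weylHeisenberg d) := by
  choose l j k h using fun g : weylHeisenberg d => exists_of_mem_weylHeisenberg d g.2
  refine Finite.of_injective (fun g => (l g, j g, k g)) fun g g' hgg => ?_
  simp only [Prod.mk.injEq] at hgg
  apply Subtype.ext
  ext z i
  rw [h g, h g', hgg.1, hgg.2.1, hgg.2.2]

noncomputable instance : Fintype (weylHeisenberg d) := Fintype.ofFinite _

variable {d}

/-- The Weyl–Heisenberg orbit `(g z)`, a sequence of vectors indexed by the group. -/
noncomputable def orbit (z : CSpace d) : weylHeisenberg d → CSpace d :=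
  fun g => (g : CSpace d ≃ₗᵢ[ℂ] CSpace d) z

/-- The set of lines spanned by the vectors of the Weyl–Heisenberg orbit of `z`. -/
def orbitLines (z : CSpace d) : Set (Submodule ℂ (CSpace d)) :=
  Set.range fun g : weylHeisenberg d => Submodule.span ℂ {orbit z g}

/-- The orbit of `z` is a Weyl–Heisenberg SIC: it gives `d²` lines, and they are equiangular. -/
def IsWeylHeisenbergSIC (z : CSpace d) : Prop :=
  (orbitLines z).ncard = d ^ 2 ∧ IsEquiangular (orbitLines z)

/-- `f_{st}(z) = ∑_r z_r z̄_{r+s} z̄_{r+t} z_{r+s+t}`. -/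
noncomputable def fST (s t : ZMod d) (z : CSpace d) : ℂ :=
  ∑ r : ZMod d, z r * star (z (r + s)) * star (z (r + t)) * z (r + s + t)

end WeylHeisenberg

end WHDesign

/-! Everything reduces to fourth-order moments, the means of `z_a z_b z̄_c z̄_e`. Over the orbit,
averaging over modulations kills such a moment unless `a + b = c + e`, and averaging over shifts
turns it into `f_{c-a,e-a}(z) / d` (`pointMean_orbit_mono₂₂`). Over the sphere, unitary invariance
makes it `A (δ_ac δ_be + δ_ae δ_bc)`. A functional with moments of this isotropic shape is a
multiple of "constant term of `Δ²`", so it vanishes on `H(2,2)`.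

The `(1,1)` moments of the orbit are isotropic automatically. Hence the orbit is a design exactly
when its mean vanishes on `H(2,2)`. Two families of harmonic test polynomials extract the
homogeneous equations, and these in turn make the orbit moments isotropic (`isTTDesign_orbit_iff`).
The identity `∑_s f_{s0} = ‖z‖⁴ = 1` then fixes the constants (`sicEquations_iff`).

For SICs, `|⟨z, Ω^k S^j z⟩|²` is a discrete Fourier transform of `s ↦ f_{s,-j}(z)`
(`normSq_overlap`). Fourier inversion matches the equations for `f_{st}` with all nontrivial squared
overlaps being `1/(d+1)` (`overlaps_iff`). This is the only possible value for an equiangular orbit,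
because all the squared overlaps sum to `d`. -/

namespace WHDesign

open MeasureTheory MvPolynomial

/-! ### Monomials of bidegree (1,1) and (2,2). -/

section Monomials

variable {ι : Type*}

/-- The monomial `z_a z̄_c`. -/
noncomputable def mono₁₁ (a c : ι) : ZPoly ι := X (Sum.inl a) * X (Sum.inr c)

/-- The monomial `z_a z_b z̄_c z̄_e`. -/
noncomputable def mono₂₂ (a b c e : ι) : ZPoly ι :=
  X (Sum.inl a) * X (Sum.inl b) * X (Sum.inr c) * X (Sum.inr e)

lemma evalZ_mono₁₁ (a c : ι) (z : EuclideanSpace ℂ ι) :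
    evalZ (mono₁₁ a c) z = z a * star (z c) := by
  simp [evalZ, mono₁₁]

lemma evalZ_mono₂₂ (a b c e : ι) (z : EuclideanSpace ℂ ι) :
    evalZ (mono₂₂ a b c e) z = z a * z b * star (z c) * star (z e) := by
  simp [evalZ, mono₂₂]

lemma mono₂₂_swap_left (a b c e : ι) : mono₂₂ a b c e = mono₂₂ b a c e := by
  unfold mono₂₂; ring

lemma mono₂₂_swap_right (a b c e : ι) : mono₂₂ a b c e = mono₂₂ a b e c := by
  unfold mono₂₂; ring

lemma continuous_evalZ (f : ZPoly ι) : Continuous (evalZ f) := by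
  unfold evalZ
  refine (MvPolynomial.continuous_eval f).comp ?_
  refine continuous_pi fun i => ?_
  rcases i with i | i
  · exact PiLp.continuous_apply 2 _ i
  · exact (PiLp.continuous_apply 2 _ i).star

lemma eq_zero_of_eq_mul_of_ne_one {c x : ℂ} (h : x = c * x) (hc : c ≠ 1) : x = 0 := by
  have : (c - 1) * x = 0 := by linear_combination -h
  exact (mul_eq_zero.1 this).resolve_left (sub_ne_zero.2 hc)

/-- The imaginary unit as an element of the circle. -/
noncomputable def circleI : Circle := ⟨Complex.I, by simp [Submonoid.unitSphere]⟩

lemma coe_update_circleI [DecidableEq ι] (k j : ι) :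
    ((Function.update (1 : ι → Circle) k circleI j : Circle) : ℂ) =
      if j = k then Complex.I else 1 := by
  rw [Function.update_apply]
  split_ifs <;> simp [circleI]

end Monomials

/-! ### Moments of the unit sphere from unitary invariance. -/

section SphereMoments

variable {ι : Type*} [Fintype ι]

-- The sphere measure of a set is, up to a fixed factor, the volume of the cone over it. A unitary
-- map commutes with real scaling, so it carries cones to cones and preserves their volume.
open scoped Pointwise in
lemma toSphere_measurePreserving (g : EuclideanSpace ℂ ι ≃ₗᵢ[ℂ] EuclideanSpace ℂ ι)
    (h : ∀ x : Metric.sphere (0 : EuclideanSpace ℂ ι) 1,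
      g x ∈ Metric.sphere (0 : EuclideanSpace ℂ ι) 1) :
    MeasurePreserving
      (fun x : Metric.sphere (0 : EuclideanSpace ℂ ι) 1 =>
        (⟨g x, h x⟩ : Metric.sphere (0 : EuclideanSpace ℂ ι) 1))
      (volume : Measure (EuclideanSpace ℂ ι)).toSphere
      (volume : Measure (EuclideanSpace ℂ ι)).toSphere := by
  have hvol : MeasurePreserving g.toHomeomorph.toMeasurableEquiv
      (volume : Measure (EuclideanSpace ℂ ι)) volume :=
    LinearIsometryEquiv.measurePreserving
      (E := EuclideanSpace ℂ ι) (F := EuclideanSpace ℂ ι)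
      { toLinearEquiv := g.toLinearEquiv.restrictScalars ℝ
        norm_map' := g.norm_map }
  have hmeas : Measurable (fun x : Metric.sphere (0 : EuclideanSpace ℂ ι) 1 =>
      (⟨g x, h x⟩ : Metric.sphere (0 : EuclideanSpace ℂ ι) 1)) :=
    ((g.continuous.comp continuous_subtype_val).subtype_mk _).measurable
  refine ⟨hmeas, ?_⟩
  ext s hs
  rw [Measure.map_apply hmeas hs, Measure.toSphere_apply' _ (hmeas hs),
    Measure.toSphere_apply' _ hs, ← hvol.measure_preimage_equiv (Set.Ioo (0 : ℝ) 1 • (Subtype.val '' s))]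
  congr 2
  ext x
  rw [Set.mem_preimage (s := Set.Ioo (0 : ℝ) 1 • (Subtype.val '' s)),
    show g.toHomeomorph.toMeasurableEquiv x = g x from rfl]
  simp only [Set.mem_smul, Set.mem_image, Set.mem_preimage, Subtype.exists, exists_and_right,
    exists_eq_right]
  constructor
  · rintro ⟨r, hr, y, ⟨hy, hys⟩, rfl⟩
    exact ⟨r, hr, g y, ⟨h ⟨y, hy⟩, hys⟩, (g.toLinearEquiv.map_smul_of_tower r y).symm⟩
  · rintro ⟨r, hr, y, ⟨hy, hys⟩, hxy⟩
    have hy' : g.symm y ∈ Metric.sphere (0 : EuclideanSpace ℂ ι) 1 := by simpa using hy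
    refine ⟨r, hr, g.symm y, ⟨hy', by simpa using hys⟩, ?_⟩
    apply g.injective
    rw [show g (r • g.symm y) = r • g (g.symm y) from g.toLinearEquiv.map_smul_of_tower r _,
      g.apply_symm_apply]
    exact hxy

lemma integral_surfaceMeasure_comp (g : EuclideanSpace ℂ ι ≃ₗᵢ[ℂ] EuclideanSpace ℂ ι)
    (F : EuclideanSpace ℂ ι → ℂ) :
    ∫ x, F (g (x : EuclideanSpace ℂ ι)) ∂(surfaceMeasure ι) =
      ∫ x, F (x : EuclideanSpace ℂ ι) ∂(surfaceMeasure ι) := by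
  have h : ∀ x : Metric.sphere (0 : EuclideanSpace ℂ ι) 1,
      g x ∈ Metric.sphere (0 : EuclideanSpace ℂ ι) 1 := fun x => by simp
  have hsymm : ∀ x : Metric.sphere (0 : EuclideanSpace ℂ ι) 1,
      g.symm x ∈ Metric.sphere (0 : EuclideanSpace ℂ ι) 1 := fun x => by simp
  let e : Metric.sphere (0 : EuclideanSpace ℂ ι) 1 ≃ₜ
      Metric.sphere (0 : EuclideanSpace ℂ ι) 1 :=
    { toFun := fun x => ⟨g x, h x⟩
      invFun := fun x => ⟨g.symm x, hsymm x⟩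
      left_inv := fun x => by simp
      right_inv := fun x => by simp
      continuous_toFun := (g.continuous.comp continuous_subtype_val).subtype_mk _
      continuous_invFun := (g.symm.continuous.comp continuous_subtype_val).subtype_mk _ }
  rw [surfaceMeasure, integral_smul_measure, integral_smul_measure,
    ← (toSphere_measurePreserving g h).integral_comp e.measurableEmbedding
      (fun x => F (x : EuclideanSpace ℂ ι))]

lemma isProbabilityMeasure_surfaceMeasure [Nonempty ι] :
    IsProbabilityMeasure (surfaceMeasure ι) := by
  constructor
  rw [surfaceMeasure, Measure.smul_apply, smul_eq_mul]
  refine ENNReal.inv_mul_cancel ?_ (measure_ne_top _ _)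
  rw [Ne, Measure.measure_univ_eq_zero]
  exact Measure.toSphere_ne_zero _

lemma integrable_evalZ [Nonempty ι] (f : ZPoly ι) :
    Integrable (fun x : Metric.sphere (0 : EuclideanSpace ℂ ι) 1 =>
      evalZ f (x : EuclideanSpace ℂ ι)) (surfaceMeasure ι) := by
  have := isProbabilityMeasure_surfaceMeasure (ι := ι)
  exact ((continuous_evalZ f).comp continuous_subtype_val).integrable_of_hasCompactSupport
    (HasCompactSupport.of_compactSpace _)

/-- The mean of a polynomial in `z` and `z̄` over the unit sphere. -/
noncomputable def sphereMean (ι : Type*) [Fintype ι] [Nonempty ι] : ZPoly ι →ₗ[ℂ] ℂ where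
  toFun f := ∫ x, evalZ f (x : EuclideanSpace ℂ ι) ∂(surfaceMeasure ι)
  map_add' f g := by
    rw [← integral_add (integrable_evalZ f) (integrable_evalZ g)]
    simp [evalZ]
  map_smul' c f := by
    rw [RingHom.id_apply, smul_eq_mul, ← integral_const_mul]
    simp [evalZ, smul_eval]

/-- Multiplication of the coordinates by complex numbers of modulus one. -/
noncomputable def diagonalPhase (u : ι → Circle) :
    EuclideanSpace ℂ ι ≃ₗᵢ[ℂ] EuclideanSpace ℂ ι where
  toFun z := WithLp.toLp 2 fun j => (u j : ℂ) * z j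
  invFun z := WithLp.toLp 2 fun j => ((u j)⁻¹ : ℂ) * z j
  map_add' x y := by ext j; simp [mul_add]
  map_smul' c x := by ext j; simp [mul_left_comm]
  left_inv x := by ext j; simp
  right_inv x := by ext j; simp
  norm_map' x := by simp [EuclideanSpace.norm_eq, Circle.norm_coe]

lemma diagonalPhase_apply (u : ι → Circle) (z : EuclideanSpace ℂ ι) (j : ι) :
    diagonalPhase u z j = u j * z j := rfl

/-- The reflection in the line spanned by `e_i + 2 e_j`. -/
noncomputable def twoReflection [DecidableEq ι] (i j : ι) : EuclideanSpace ℂ ι ≃ₗᵢ[ℂ] EuclideanSpace ℂ ι :=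
  (ℂ ∙ (EuclideanSpace.single i (1 : ℂ) + EuclideanSpace.single j (2 : ℂ))).reflection

/-- The vector `e_i + 2 e_j` has squared norm 5, so this unitary mixes two coordinates with rational
coefficients and no square roots arise. -/
lemma twoReflection_apply [DecidableEq ι] {i j : ι} (h : i ≠ j) (z : EuclideanSpace ℂ ι) :
    twoReflection i j z i = (-3 / 5 : ℂ) * z i + (4 / 5 : ℂ) * z j := by
  have hn : ((‖EuclideanSpace.single i (1 : ℂ) + EuclideanSpace.single j (2 : ℂ)‖ : ℝ) : ℂ) ^ 2
      = 5 := by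
    refine (inner_self_eq_norm_sq_to_K (𝕜 := ℂ)
      (EuclideanSpace.single i (1 : ℂ) + EuclideanSpace.single j (2 : ℂ))).symm.trans ?_
    have h2 : (starRingEnd ℂ) 2 = 2 := Complex.conj_ofNat 2
    rw [inner_add_left, EuclideanSpace.inner_single_left, EuclideanSpace.inner_single_left]
    simp [h, h.symm, h2]
    norm_num
  rw [twoReflection, Submodule.reflection_singleton_apply]
  erw [hn]
  have h2 : (starRingEnd ℂ) 2 = 2 := Complex.conj_ofNat 2
  simp [inner_add_left, EuclideanSpace.inner_single_left, h, h2]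
  ring

variable [Nonempty ι]

lemma sphereMean_apply (f : ZPoly ι) :
    sphereMean ι f = ∫ x, evalZ f (x : EuclideanSpace ℂ ι) ∂(surfaceMeasure ι) := rfl

lemma sphereMean_C (c : ℂ) : sphereMean ι (C c) = c := by
  have := isProbabilityMeasure_surfaceMeasure (ι := ι)
  simp [sphereMean_apply, evalZ]

lemma sphereMean_eq_of_evalZ (g : EuclideanSpace ℂ ι ≃ₗᵢ[ℂ] EuclideanSpace ℂ ι) {p q : ZPoly ι}
    (h : ∀ x, evalZ p (g x) = evalZ q x) : sphereMean ι p = sphereMean ι q := by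
  rw [sphereMean_apply, sphereMean_apply, ← integral_surfaceMeasure_comp g (evalZ p)]
  simp only [h]

lemma sphereMean_mono₂₂_phase (u : ι → Circle) (a b c e : ι) :
    sphereMean ι (mono₂₂ a b c e) =
      ((u a : ℂ) * u b * star (u c : ℂ) * star (u e : ℂ)) * sphereMean ι (mono₂₂ a b c e) := by
  rw [← smul_eq_mul, ← map_smul]
  refine sphereMean_eq_of_evalZ (diagonalPhase u) fun x => ?_
  have h : evalZ (((u a : ℂ) * u b * star (u c : ℂ) * star (u e : ℂ)) • mono₂₂ a b c e) x =
      ((u a : ℂ) * u b * star (u c : ℂ) * star (u e : ℂ)) * evalZ (mono₂₂ a b c e) x := by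
    simp [evalZ, smul_eval]
  rw [h, evalZ_mono₂₂, evalZ_mono₂₂]
  simp only [diagonalPhase_apply, star_mul']
  ring

lemma sphereMean_mono₁₁_phase (u : ι → Circle) (a c : ι) :
    sphereMean ι (mono₁₁ a c) =
      ((u a : ℂ) * star (u c : ℂ)) * sphereMean ι (mono₁₁ a c) := by
  rw [← smul_eq_mul, ← map_smul]
  refine sphereMean_eq_of_evalZ (diagonalPhase u) fun x => ?_
  have h : evalZ (((u a : ℂ) * star (u c : ℂ)) • mono₁₁ a c) x =
      ((u a : ℂ) * star (u c : ℂ)) * evalZ (mono₁₁ a c) x := by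
    simp [evalZ, smul_eval]
  rw [h, evalZ_mono₁₁, evalZ_mono₁₁]
  simp only [diagonalPhase_apply, star_mul']
  ring

variable [DecidableEq ι]

lemma sphereMean_mono₁₁_of_ne {a c : ι} (h : a ≠ c) : sphereMean ι (mono₁₁ a c) = 0 := by
  refine eq_zero_of_eq_mul_of_ne_one
    (sphereMean_mono₁₁_phase (Function.update (1 : ι → Circle) a circleI) a c) ?_
  simp only [coe_update_circleI, if_neg h.symm]
  simp [Complex.ext_iff]

/-- Rotating coordinate `a` by `i` multiplies the monomial by `i` if `b ≠ a` and by `i² = -1` if `b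
= a`. Neither factor is 1, so the invariant mean is zero. -/
lemma sphereMean_mono₂₂_of_left {a b c e : ι} (hc : a ≠ c) (he : a ≠ e) :
    sphereMean ι (mono₂₂ a b c e) = 0 := by
  refine eq_zero_of_eq_mul_of_ne_one
    (sphereMean_mono₂₂_phase (Function.update (1 : ι → Circle) a circleI) a b c e) ?_
  simp only [coe_update_circleI, if_neg hc.symm, if_neg he.symm]
  by_cases h : b = a <;> norm_num [Complex.ext_iff, h]

lemma sphereMean_mono₂₂_of_right {a b c e : ι} (ha : a ≠ c) (hb : b ≠ c) :
    sphereMean ι (mono₂₂ a b c e) = 0 := by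
  refine eq_zero_of_eq_mul_of_ne_one
    (sphereMean_mono₂₂_phase (Function.update (1 : ι → Circle) c circleI) a b c e) ?_
  simp only [coe_update_circleI, if_neg ha, if_neg hb]
  by_cases h : e = c <;> norm_num [Complex.ext_iff, h]

lemma sphereMean_mono₁₁_diag (i j : ι) :
    sphereMean ι (mono₁₁ i i) = sphereMean ι (mono₁₁ j j) := by
  rcases eq_or_ne i j with rfl | h
  · rfl
  have key : sphereMean ι (mono₁₁ i i) = sphereMean ι
      ((9 / 25 : ℂ) • mono₁₁ i i + (-12 / 25 : ℂ) • mono₁₁ i j + (-12 / 25 : ℂ) • mono₁₁ j i +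
        (16 / 25 : ℂ) • mono₁₁ j j) := by
    refine sphereMean_eq_of_evalZ (twoReflection i j) fun x => ?_
    rw [evalZ_mono₁₁, twoReflection_apply h]
    simp [evalZ, mono₁₁, smul_eval]
    ring
  simp only [map_add, map_smul, smul_eq_mul, sphereMean_mono₁₁_of_ne h,
    sphereMean_mono₁₁_of_ne h.symm] at key
  linear_combination (25 / 16 : ℂ) * key

/-- Expansion of `|-3 z_i + 4 z_j|⁴`: the coefficients are `3⁴`, `4⁴` and `4 · (3 · 4)²`. Every
other term dies by phase invariance. -/
lemma sphereMean_mono₂₂_reflection {i j : ι} (h : i ≠ j) :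
    625 * sphereMean ι (mono₂₂ i i i i) = 81 * sphereMean ι (mono₂₂ i i i i) +
      256 * sphereMean ι (mono₂₂ j j j j) + 576 * sphereMean ι (mono₂₂ i j i j) := by
  have key : sphereMean ι (mono₂₂ i i i i) = sphereMean ι
      ((81 / 625 : ℂ) • mono₂₂ i i i i + (256 / 625 : ℂ) • mono₂₂ j j j j +
        (576 / 625 : ℂ) • mono₂₂ i j i j + (-216 / 625 : ℂ) • mono₂₂ i i i j +
        (144 / 625 : ℂ) • mono₂₂ i i j j + (-216 / 625 : ℂ) • mono₂₂ i j i i +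
        (-384 / 625 : ℂ) • mono₂₂ i j j j + (144 / 625 : ℂ) • mono₂₂ j j i i +
        (-384 / 625 : ℂ) • mono₂₂ j j i j) := by
    refine sphereMean_eq_of_evalZ (twoReflection i j) fun x => ?_
    rw [evalZ_mono₂₂, twoReflection_apply h]
    simp [evalZ, mono₂₂, smul_eval]
    ring
  have h1 : sphereMean ι (mono₂₂ i i i j) = 0 := by
    rw [mono₂₂_swap_right]; exact sphereMean_mono₂₂_of_right h h
  have h2 : sphereMean ι (mono₂₂ i i j j) = 0 := sphereMean_mono₂₂_of_left h h
  have h3 : sphereMean ι (mono₂₂ i j i i) = 0 := by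
    rw [mono₂₂_swap_left]; exact sphereMean_mono₂₂_of_left h.symm h.symm
  have h4 : sphereMean ι (mono₂₂ i j j j) = 0 := sphereMean_mono₂₂_of_left h h
  have h5 : sphereMean ι (mono₂₂ j j i i) = 0 := sphereMean_mono₂₂_of_left h.symm h.symm
  have h6 : sphereMean ι (mono₂₂ j j i j) = 0 := sphereMean_mono₂₂_of_right h.symm h.symm
  simp only [map_add, map_smul, smul_eq_mul, h1, h2, h3, h4, h5, h6] at key
  linear_combination 625 * key

lemma sphereMean_mono₂₂_diag {i j : ι} (h : i ≠ j) :
    sphereMean ι (mono₂₂ i i i i) = sphereMean ι (mono₂₂ j j j j) ∧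
      sphereMean ι (mono₂₂ i i i i) = 2 * sphereMean ι (mono₂₂ i j i j) := by
  have h1 := sphereMean_mono₂₂_reflection h
  have h2 := sphereMean_mono₂₂_reflection h.symm
  rw [mono₂₂_swap_left j i, mono₂₂_swap_right i j j i] at h2
  have h3 : sphereMean ι (mono₂₂ i i i i) = sphereMean ι (mono₂₂ j j j j) := by
    linear_combination (1 / 800 : ℂ) * h1 - (1 / 800 : ℂ) * h2
  exact ⟨h3, by linear_combination (1 / 288 : ℂ) * h1 - (256 / 288 : ℂ) * h3⟩

lemma exists_sphereMean_mono₁₁ :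
    ∃ A : ℂ, ∀ a c : ι, sphereMean ι (mono₁₁ a c) = A * if a = c then 1 else 0 := by
  obtain ⟨i⟩ := ‹Nonempty ι›
  refine ⟨sphereMean ι (mono₁₁ i i), fun a c => ?_⟩
  by_cases h : a = c
  · subst h; simp [sphereMean_mono₁₁_diag a i]
  · simp [h, sphereMean_mono₁₁_of_ne h]

/-- Phase invariance leaves only monomials with `{a, b} = {c, e}` as multisets. The number of
pairings is 2 when `a = b` and 1 otherwise, matching the ratio in `sphereMean_mono₂₂_diag`. -/
lemma exists_sphereMean_mono₂₂ :
    ∃ A : ℂ, ∀ a b c e : ι, sphereMean ι (mono₂₂ a b c e) =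
      A * ((if a = c then 1 else 0) * (if b = e then 1 else 0) +
        (if a = e then 1 else 0) * (if b = c then 1 else 0)) := by
  have i : ι := Classical.arbitrary ι
  have hdiag : ∀ j, sphereMean ι (mono₂₂ j j j j) = sphereMean ι (mono₂₂ i i i i) := fun j => by
    rcases eq_or_ne j i with rfl | h
    · rfl
    · exact (sphereMean_mono₂₂_diag h).1
  have hoff : ∀ j k, j ≠ k →
      sphereMean ι (mono₂₂ j k j k) = sphereMean ι (mono₂₂ i i i i) / 2 := fun j k h => by
    linear_combination (1 / 2 : ℂ) * hdiag j - (1 / 2 : ℂ) * (sphereMean_mono₂₂_diag h).2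
  refine ⟨sphereMean ι (mono₂₂ i i i i) / 2, fun a b c e => ?_⟩
  by_cases hac : a = c
  · subst hac
    by_cases hbe : b = e
    · subst hbe
      by_cases hab : a = b
      · subst hab
        rw [hdiag]; simp; ring
      · rw [hoff a b hab]; simp [hab]
    · rw [mono₂₂_swap_left, mono₂₂_swap_right] at *
      by_cases hba : b = a
      · subst hba
        rw [sphereMean_mono₂₂_of_right hbe hbe]; simp [hbe]
      · rw [sphereMean_mono₂₂_of_left hbe hba]; simp [hba, hbe]
  · by_cases hae : a = e
    · subst hae
      by_cases hbc : b = c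
      · subst hbc
        rw [mono₂₂_swap_right, hoff a b hac]; simp [hac]
      · rw [sphereMean_mono₂₂_of_right hac hbc]; simp [hac, hbc]
    · rw [sphereMean_mono₂₂_of_left hac hae]; simp [hac, hae]

end SphereMoments

/-! ### Functionals on polynomials of fixed bidegree. -/

section Polynomials

variable {ι : Type*}

/-- The bidegree of the variables `z_j` and `z̄_j`. -/
def bidegree (ι : Type*) : ι ⊕ ι → ℕ × ℕ :=
  Sum.elim (fun _ : ι => ((1, 0) : ℕ × ℕ)) (fun _ : ι => ((0, 1) : ℕ × ℕ))

/-- Positive degree in `z` forces some `z_a` to occur. Peeling off one variable at a time identifies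
the monomials of bidegree (1,1) and (2,2). -/
lemma exists_inl_of_weight {p q : ℕ} {m : ι ⊕ ι →₀ ℕ}
    (h : Finsupp.weight (bidegree ι) m = (p + 1, q)) :
    ∃ (a : ι) (m' : ι ⊕ ι →₀ ℕ), m = Finsupp.single (Sum.inl a) 1 + m' ∧
      Finsupp.weight (bidegree ι) m' = (p, q) := by
  have hex : ∃ a : ι, m (Sum.inl a) ≠ 0 := by
    by_contra! hcon
    have h1 : (Finsupp.weight (bidegree ι) m).1 = 0 := by
      rw [Finsupp.weight_apply, Finsupp.sum, Prod.fst_sum]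
      refine Finset.sum_eq_zero fun i _ => ?_
      rcases i with i | i <;> simp [bidegree, hcon]
    rw [h] at h1
    simp at h1
  obtain ⟨a, ha⟩ := hex
  have hle : Finsupp.single (Sum.inl a) 1 ≤ m :=
    Finsupp.single_le_iff.2 (Nat.one_le_iff_ne_zero.2 ha)
  refine ⟨a, m - Finsupp.single (Sum.inl a) 1, (add_tsub_cancel_of_le hle).symm, ?_⟩
  rw [← add_tsub_cancel_of_le hle, map_add, Finsupp.weight_single] at h
  simp only [bidegree, Sum.elim_inl, one_smul, Prod.ext_iff, Prod.fst_add, Prod.snd_add] at h ⊢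
  omega

lemma exists_inr_of_weight {p q : ℕ} {m : ι ⊕ ι →₀ ℕ}
    (h : Finsupp.weight (bidegree ι) m = (p, q + 1)) :
    ∃ (a : ι) (m' : ι ⊕ ι →₀ ℕ), m = Finsupp.single (Sum.inr a) 1 + m' ∧
      Finsupp.weight (bidegree ι) m' = (p, q) := by
  have hex : ∃ a : ι, m (Sum.inr a) ≠ 0 := by
    by_contra! hcon
    have h1 : (Finsupp.weight (bidegree ι) m).2 = 0 := by
      rw [Finsupp.weight_apply, Finsupp.sum, Prod.snd_sum]
      refine Finset.sum_eq_zero fun i _ => ?_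
      rcases i with i | i <;> simp [bidegree, hcon]
    rw [h] at h1
    simp at h1
  obtain ⟨a, ha⟩ := hex
  have hle : Finsupp.single (Sum.inr a) 1 ≤ m :=
    Finsupp.single_le_iff.2 (Nat.one_le_iff_ne_zero.2 ha)
  refine ⟨a, m - Finsupp.single (Sum.inr a) 1, (add_tsub_cancel_of_le hle).symm, ?_⟩
  rw [← add_tsub_cancel_of_le hle, map_add, Finsupp.weight_single] at h
  simp only [bidegree, Sum.elim_inr, one_smul, Prod.ext_iff, Prod.fst_add, Prod.snd_add] at h ⊢
  omega

lemma eq_zero_of_weight {m : ι ⊕ ι →₀ ℕ} (h : Finsupp.weight (bidegree ι) m = (0, 0)) :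
    m = 0 := by
  ext i
  by_contra hi
  rw [Finsupp.coe_zero, Pi.zero_apply] at hi
  have hle : Finsupp.single i 1 ≤ m := Finsupp.single_le_iff.2 (Nat.one_le_iff_ne_zero.2 hi)
  rw [← add_tsub_cancel_of_le hle, map_add, Finsupp.weight_single] at h
  rcases i with i | i <;> simp [bidegree, Prod.ext_iff] at h

lemma monomial_single_add_one (i : ι ⊕ ι) (m : ι ⊕ ι →₀ ℕ) :
    (monomial (Finsupp.single i 1 + m) 1 : ZPoly ι) = X i * monomial m 1 := by
  rw [X, monomial_mul, one_mul]

lemma homPoly_ext {p q : ℕ} (L L' : ZPoly ι →ₗ[ℂ] ℂ)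
    (h : ∀ m : ι ⊕ ι →₀ ℕ, Finsupp.weight (bidegree ι) m = (p, q) →
      L (monomial m 1) = L' (monomial m 1)) {f : ZPoly ι} (hf : f ∈ homPoly ι p q) :
    L f = L' f := by
  rw [f.as_sum, map_sum, map_sum]
  refine Finset.sum_congr rfl fun m hm => ?_
  have hw : Finsupp.weight (bidegree ι) m = (p, q) := hf (mem_support_iff.1 hm)
  rw [show monomial m (coeff m f) = coeff m f • (monomial m 1 : ZPoly ι) by
    rw [smul_monomial, smul_eq_mul, mul_one], map_smul, map_smul, h m hw]

lemma homPoly_zero_ext (L L' : ZPoly ι →ₗ[ℂ] ℂ) (h : L 1 = L' 1)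
    {f : ZPoly ι} (hf : f ∈ homPoly ι 0 0) : L f = L' f := by
  refine homPoly_ext L L' (fun m hm => ?_) hf
  rw [eq_zero_of_weight hm]
  exact h

lemma homPoly_one_ext (L L' : ZPoly ι →ₗ[ℂ] ℂ)
    (h : ∀ a c, L (mono₁₁ a c) = L' (mono₁₁ a c))
    {f : ZPoly ι} (hf : f ∈ homPoly ι 1 1) : L f = L' f := by
  refine homPoly_ext L L' (fun m hm => ?_) hf
  obtain ⟨a, m₁, rfl, hm₁⟩ := exists_inl_of_weight hm
  obtain ⟨c, m₂, rfl, hm₂⟩ := exists_inr_of_weight hm₁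
  obtain rfl := eq_zero_of_weight hm₂
  have : (monomial (Finsupp.single (Sum.inl a) 1 + (Finsupp.single (Sum.inr c) 1 + 0)) 1 :
      ZPoly ι) = mono₁₁ a c := by
    simp only [monomial_single_add_one, mono₁₁, monomial_zero', C_1, mul_one]
  rw [this, h]

lemma homPoly_two_ext (L L' : ZPoly ι →ₗ[ℂ] ℂ)
    (h : ∀ a b c e, L (mono₂₂ a b c e) = L' (mono₂₂ a b c e))
    {f : ZPoly ι} (hf : f ∈ homPoly ι 2 2) : L f = L' f := by
  refine homPoly_ext L L' (fun m hm => ?_) hf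
  obtain ⟨a, m₁, rfl, hm₁⟩ := exists_inl_of_weight hm
  obtain ⟨b, m₂, rfl, hm₂⟩ := exists_inl_of_weight hm₁
  obtain ⟨c, m₃, rfl, hm₃⟩ := exists_inr_of_weight hm₂
  obtain ⟨e, m₄, rfl, hm₄⟩ := exists_inr_of_weight hm₃
  obtain rfl := eq_zero_of_weight hm₄
  have : (monomial (Finsupp.single (Sum.inl a) 1 + (Finsupp.single (Sum.inl b) 1 +
      (Finsupp.single (Sum.inr c) 1 + (Finsupp.single (Sum.inr e) 1 + 0)))) 1 :
      ZPoly ι) = mono₂₂ a b c e := by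
    simp only [monomial_single_add_one, mono₂₂, monomial_zero', C_1, mul_one, mul_assoc]
  rw [this, h]

lemma mono₂₂_mem_homPoly (a b c e : ι) : mono₂₂ a b c e ∈ homPoly ι 2 2 :=
  (((isWeightedHomogeneous_X ℂ (bidegree ι) (Sum.inl a)).mul
    (isWeightedHomogeneous_X ℂ (bidegree ι) (Sum.inl b))).mul
    (isWeightedHomogeneous_X ℂ (bidegree ι) (Sum.inr c))).mul
    (isWeightedHomogeneous_X ℂ (bidegree ι) (Sum.inr e))

end Polynomials

/-! ### The Laplacian, and functionals that factor through it. -/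

section Laplacian

variable {ι : Type*} [Fintype ι]

lemma laplacian_apply (f : ZPoly ι) :
    laplacian ι f = ∑ j, pderiv (Sum.inl j) (pderiv (Sum.inr j) f) := by
  simp [laplacian]

variable [DecidableEq ι]

lemma laplacian_mono₁₁ (a c : ι) :
    laplacian ι (mono₁₁ a c) = C (if a = c then 1 else 0) := by
  rw [laplacian_apply, Finset.sum_eq_single c]
  · simp [mono₁₁, pderiv_X, Pi.single_apply]
  · intro j _ hj
    simp [mono₁₁, pderiv_X, hj.symm]
  · simp

lemma laplacian_mono₂₂ (a b c e : ι) :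
    laplacian ι (mono₂₂ a b c e) =
      (if a = c then (1 : ℂ) else 0) • mono₁₁ b e + (if a = e then (1 : ℂ) else 0) • mono₁₁ b c +
      (if b = c then (1 : ℂ) else 0) • mono₁₁ a e +
      (if b = e then (1 : ℂ) else 0) • mono₁₁ a c := by
  have hj : ∀ j, pderiv (Sum.inl j) (pderiv (Sum.inr j) (mono₂₂ a b c e)) =
      (if c = j then if a = j then (1 : ℂ) else 0 else 0) • mono₁₁ b e +
      (if e = j then if a = j then (1 : ℂ) else 0 else 0) • mono₁₁ b c +
      (if c = j then if b = j then (1 : ℂ) else 0 else 0) • mono₁₁ a e +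
      (if e = j then if b = j then (1 : ℂ) else 0 else 0) • mono₁₁ a c := by
    intro j
    simp only [mono₂₂, mono₁₁, Derivation.leibniz, pderiv_X, Pi.single_apply, smul_eq_mul,
      map_add, Sum.inl.injEq, Sum.inr.injEq, reduceCtorEq, if_false, mul_zero, add_zero, zero_add]
    split_ifs <;> simp <;> ring
  rw [laplacian_apply, Finset.sum_congr rfl fun j _ => hj j]
  simp only [Finset.sum_add_distrib, ← Finset.sum_smul, Finset.sum_ite_eq, Finset.mem_univ,
    if_true]

/-- A linear functional whose moments of bidegree `(1, 1)` are those of an isotropic measure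
vanishes on `H(1, 1)`. -/
lemma harmPoly_one_eq_zero (L : ZPoly ι →ₗ[ℂ] ℂ) (A : ℂ)
    (h : ∀ a c, L (mono₁₁ a c) = A * if a = c then 1 else 0)
    {f : ZPoly ι} (hf : f ∈ harmPoly ι 1 1) : L f = 0 := by
  -- On bidegree (1,1) the functional equals `A` times the constant term of the Laplacian, which is
  -- zero on harmonic polynomials.
  rw [homPoly_one_ext L (A • lcoeff ℂ 0 ∘ₗ laplacian ι) (fun a c => ?_) hf.1]
  · simp [LinearMap.mem_ker.1 hf.2]
  · rw [h, LinearMap.smul_apply, LinearMap.comp_apply, laplacian_mono₁₁, lcoeff_apply, coeff_zero_C,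
      smul_eq_mul]

/-- A linear functional whose moments of bidegree `(2, 2)` are those of an isotropic measure
vanishes on `H(2, 2)`. -/
lemma harmPoly_two_eq_zero (L : ZPoly ι →ₗ[ℂ] ℂ) (A : ℂ)
    (h : ∀ a b c e, L (mono₂₂ a b c e) =
      A * ((if a = c then 1 else 0) * (if b = e then 1 else 0) +
        (if a = e then 1 else 0) * (if b = c then 1 else 0)))
    {f : ZPoly ι} (hf : f ∈ harmPoly ι 2 2) : L f = 0 := by
  -- The factor is `A / 2` because `Δ²` of the monomial produces each of the two pairings twice.
  rw [homPoly_two_ext L ((A / 2) • lcoeff ℂ 0 ∘ₗ laplacian ι ∘ₗ laplacian ι)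
    (fun a b c e => ?_) hf.1]
  · simp [LinearMap.mem_ker.1 hf.2]
  · rw [h, LinearMap.smul_apply, LinearMap.comp_apply, LinearMap.comp_apply, laplacian_mono₂₂]
    simp only [map_add, map_smul, laplacian_mono₁₁, lcoeff_apply, coeff_zero_C, smul_eq_mul]
    ring

lemma mono₂₂_mem_harmPoly {a b c e : ι} (hac : a ≠ c) (hae : a ≠ e) (hbc : b ≠ c) (hbe : b ≠ e) :
    mono₂₂ a b c e ∈ harmPoly ι 2 2 := by
  refine ⟨mono₂₂_mem_homPoly a b c e, ?_⟩
  rw [SetLike.mem_coe, LinearMap.mem_ker, laplacian_mono₂₂]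
  simp [hac, hae, hbc, hbe]

/-- Since `Δ|z_a|⁴ = 4|z_a|²` and `Δ(|z_a|²|z_b|²) = |z_a|² + |z_b|²`, the coefficient 4 produces
cancellation. -/
lemma mono₂₂_comb_mem_harmPoly {a b : ι} (hab : a ≠ b) :
    mono₂₂ a a a a - (4 : ℂ) • mono₂₂ a b b a + mono₂₂ b b b b ∈ harmPoly ι 2 2 := by
  refine ⟨add_mem (sub_mem (mono₂₂_mem_homPoly _ _ _ _)
    (Submodule.smul_mem _ _ (mono₂₂_mem_homPoly _ _ _ _))) (mono₂₂_mem_homPoly _ _ _ _), ?_⟩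
  rw [SetLike.mem_coe, LinearMap.mem_ker, map_add, map_sub, map_smul, laplacian_mono₂₂,
    laplacian_mono₂₂, laplacian_mono₂₂]
  simp only [hab, hab.symm, if_true, if_false, one_smul, zero_smul, zero_add, add_zero]
  module

end Laplacian

/-! ### Reduction of the design condition to `H(2,2)`. -/

section Designs

variable {ι : Type*} [Fintype ι]

lemma tauPoly_two_eq_iff (L L' : ZPoly ι →ₗ[ℂ] ℂ) :
    (∀ f ∈ tauPoly ι {i : ℕ × ℕ | i.1 = i.2 ∧ i.1 ≤ 2}, L f = L' f) ↔
      (∀ f ∈ harmPoly ι 0 0, L f = L' f) ∧ (∀ f ∈ harmPoly ι 1 1, L f = L' f) ∧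
        ∀ f ∈ harmPoly ι 2 2, L f = L' f := by
  constructor
  · intro h
    have hle : ∀ n ≤ 2, harmPoly ι n n ≤ tauPoly ι {i : ℕ × ℕ | i.1 = i.2 ∧ i.1 ≤ 2} :=
      fun n hn => le_iSup₂_of_le (f := fun (i : ℕ × ℕ) (_ : i ∈ {i : ℕ × ℕ | i.1 = i.2 ∧ i.1 ≤ 2})
        => harmPoly ι i.1 i.2) (n, n) ⟨rfl, hn⟩ le_rfl
    exact ⟨fun f hf => h f (hle 0 (by norm_num) hf), fun f hf => h f (hle 1 (by norm_num) hf),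
      fun f hf => h f (hle 2 le_rfl hf)⟩
  · rintro ⟨h0, h1, h2⟩ f hf
    have hle : tauPoly ι {i : ℕ × ℕ | i.1 = i.2 ∧ i.1 ≤ 2} ≤ LinearMap.eqLocus L L' := by
      refine iSup₂_le ?_
      rintro ⟨p, q⟩ ⟨rfl : p = q, hp : p ≤ 2⟩
      interval_cases p
      exacts [h0, h1, h2]
    exact hle hf

/-- The mean of a polynomial in `z` and `z̄` over a finite sequence of points. -/
noncomputable def pointMean {κ : Type*} [Fintype κ] (Y : κ → EuclideanSpace ℂ ι) :
    ZPoly ι →ₗ[ℂ] ℂ where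
  toFun f := (1 / (Fintype.card κ : ℂ)) * ∑ k, evalZ f (Y k)
  map_add' f g := by simp [evalZ, Finset.sum_add_distrib, mul_add]
  map_smul' c f := by
    simp only [evalZ, smul_eval, ← Finset.mul_sum, RingHom.id_apply, smul_eq_mul]
    ring

/-- Sequences of unit vectors with isotropic moments of bidegree `(1, 1)` are
`(2, 2)`-designs when they average the polynomials in `H(2, 2)` to zero. -/
lemma isTTDesign_two_iff [Nonempty ι] [DecidableEq ι] {κ : Type*} [Fintype κ] [Nonempty κ]
    (Y : κ → EuclideanSpace ℂ ι) (hY : ∀ k, ‖Y k‖ = 1) (A : ℂ)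
    (h : ∀ a c, pointMean Y (mono₁₁ a c) = A * if a = c then 1 else 0) :
    IsTTDesign 2 Y ↔ ∀ f ∈ harmPoly ι 2 2, pointMean Y f = 0 := by
  have hiff : IsTTDesign 2 Y ↔ ∀ f ∈ tauPoly ι {i : ℕ × ℕ | i.1 = i.2 ∧ i.1 ≤ 2},
      sphereMean ι f = pointMean Y f :=
    ⟨fun H => H.2, fun H => ⟨hY, H⟩⟩
  have h0 : ∀ f ∈ harmPoly ι 0 0, sphereMean ι f = pointMean Y f := fun f hf => by
    refine homPoly_zero_ext _ _ ?_ hf.1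
    rw [← C_1, sphereMean_C]
    simp [pointMean, evalZ]
  obtain ⟨B, hB⟩ := exists_sphereMean_mono₁₁ (ι := ι)
  have h1 : ∀ f ∈ harmPoly ι 1 1, sphereMean ι f = pointMean Y f := fun f hf => by
    rw [harmPoly_one_eq_zero _ A h hf, harmPoly_one_eq_zero _ B hB hf]
  obtain ⟨D, hD⟩ := exists_sphereMean_mono₂₂ (ι := ι)
  rw [hiff, tauPoly_two_eq_iff]
  constructor
  · rintro ⟨-, -, h2⟩ f hf
    rw [← h2 f hf, harmPoly_two_eq_zero _ D hD hf]
  · intro h2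
    exact ⟨h0, h1, fun f hf => by rw [h2 f hf, harmPoly_two_eq_zero _ D hD hf]⟩

end Designs

/-! ### Moments of a Weyl–Heisenberg orbit. -/

section Displacement

variable {d : ℕ} [NeZero d]

lemma star_stdAddChar (x : ZMod d) :
    star (ZMod.stdAddChar x : ℂ) = ZMod.stdAddChar (-x) := by
  rw [AddChar.map_neg_eq_conj]; rfl

lemma sum_stdAddChar_mul (x : ZMod d) :
    ∑ k : ZMod d, (ZMod.stdAddChar (k * x) : ℂ) = if x = 0 then (d : ℂ) else 0 := by
  rw [AddChar.sum_mulShift x (ZMod.isPrimitive_stdAddChar d), ZMod.card]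
  split_ifs <;> simp

lemma shift_pow_apply (n : ℕ) (z : CSpace d) (i : ZMod d) :
    (shift d ^ n) z i = z (i - n) := by
  induction n generalizing z with
  | zero => simp
  | succ n ih =>
    rw [pow_succ]
    change (shift d ^ n) (shift d z) i = _
    rw [ih, shift_apply, Nat.cast_succ, sub_sub]

lemma modulation_pow_apply (n : ℕ) (z : CSpace d) (i : ZMod d) :
    (modulation d ^ n) z i = ZMod.stdAddChar ((n : ZMod d) * i) * z i := by
  induction n generalizing z with
  | zero => simp
  | succ n ih =>
    rw [pow_succ]
    change (modulation d ^ n) (modulation d z) i = _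
    rw [ih, modulation_apply, ← mul_assoc, ← AddChar.map_add_eq_mul, Nat.cast_succ, add_mul,
      one_mul]

/-- The displacement operator `Ω^k S^j`. -/
noncomputable def displacement (j k : ZMod d) : weylHeisenberg d :=
  ⟨modulation d ^ k.val * shift d ^ j.val,
    mul_mem (pow_mem (Subgroup.subset_closure (by simp)) _)
      (pow_mem (Subgroup.subset_closure (by simp)) _)⟩

lemma displacement_apply (j k : ZMod d) (z : CSpace d) (i : ZMod d) :
    (displacement j k : CSpace d ≃ₗᵢ[ℂ] CSpace d) z i =
      ZMod.stdAddChar (k * i) * z (i - j) := by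
  change (modulation d ^ k.val) ((shift d ^ j.val) z) i = _
  rw [modulation_pow_apply, shift_pow_apply, ZMod.natCast_zmod_val, ZMod.natCast_zmod_val]

lemma fST_comm (s t : ZMod d) (z : CSpace d) : fST s t z = fST t s z := by
  unfold fST
  refine Finset.sum_congr rfl fun r _ => ?_
  rw [add_right_comm r s t]
  ring

/-- Group elements act by a shift and a phase affine in the index. The shift only reindexes the sum,
and the phases cancel because `r + (r+s+t) = (r+s) + (r+t)`. -/
lemma fST_weylHeisenberg (s t : ZMod d) (g : weylHeisenberg d) (z : CSpace d) :
    fST s t ((g : CSpace d ≃ₗᵢ[ℂ] CSpace d) z) = fST s t z := by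
  obtain ⟨l, j, k, h⟩ := exists_of_mem_weylHeisenberg d g.2
  unfold fST
  rw [← Equiv.sum_comp (Equiv.subRight j)
    (fun r => z r * star (z (r + s)) * star (z (r + t)) * z (r + s + t))]
  refine Finset.sum_congr rfl fun r _ => ?_
  have hχ : (ZMod.stdAddChar (l + k * r) : ℂ) * ZMod.stdAddChar (-(l + k * (r + s))) *
      ZMod.stdAddChar (-(l + k * (r + t))) * ZMod.stdAddChar (l + k * (r + s + t)) = 1 := by
    rw [← AddChar.map_add_eq_mul, ← AddChar.map_add_eq_mul, ← AddChar.map_add_eq_mul,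
      ← AddChar.map_zero_eq_one (ZMod.stdAddChar (N := d))]
    congr 1
    ring
  simp only [h, star_mul', star_stdAddChar, Equiv.subRight_apply]
  rw [show r - j + s = r + s - j by ring, show r - j + t = r + t - j by ring,
    show r + s - j + t = r + s + t - j by ring]
  linear_combination
    (z (r - j) * star (z (r + s - j)) * star (z (r + t - j)) * z (r + s + t - j)) * hχ

/-- Character orthogonality in `k` forces `a + b = c + e`. Putting `r = a - j` then makes the sum
over `j` the defining sum of `fST`, with `b - j = r + (c-a) + (e-a)`. -/
lemma sum_displacement_mono₂₂ (a b c e : ZMod d) (w : CSpace d) :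
    ∑ j : ZMod d, ∑ k : ZMod d, evalZ (mono₂₂ a b c e) ((displacement j k : CSpace d ≃ₗᵢ[ℂ] CSpace d) w) =
      if a + b = c + e then d * fST (c - a) (e - a) w else 0 := by
  have hk : ∀ j, ∑ k : ZMod d, evalZ (mono₂₂ a b c e) ((displacement j k : CSpace d ≃ₗᵢ[ℂ] CSpace d) w) =
      (if a + b - c - e = 0 then (d : ℂ) else 0) *
        (w (a - j) * w (b - j) * star (w (c - j)) * star (w (e - j))) := fun j => by
    rw [← sum_stdAddChar_mul, Finset.sum_mul]
    refine Finset.sum_congr rfl fun k _ => ?_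
    rw [evalZ_mono₂₂]
    simp only [displacement_apply, star_mul', star_stdAddChar]
    rw [show k * (a + b - c - e) = k * a + k * b + -(k * c) + -(k * e) by ring]
    simp only [AddChar.map_add_eq_mul]
    ring
  rw [Finset.sum_congr rfl fun j _ => hk j, ← Finset.mul_sum]
  have hiff : a + b - c - e = 0 ↔ a + b = c + e := by rw [sub_sub, sub_eq_zero]
  simp only [hiff]
  split_ifs with h
  · congr 1
    unfold fST
    rw [← Equiv.sum_comp (Equiv.subLeft a)]
    refine Finset.sum_congr rfl fun j _ => ?_
    simp only [Equiv.subLeft_apply]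
    rw [show a - (a - j) = j by ring, show b - (a - j) = j + (c - a) + (e - a) by
      linear_combination h, show c - (a - j) = j + (c - a) by ring,
      show e - (a - j) = j + (e - a) by ring]
    ring
  · rw [zero_mul]

lemma sum_mul_star_self (w : CSpace d) : ∑ r, w r * star (w r) = ((‖w‖ ^ 2 : ℝ) : ℂ) := by
  rw [EuclideanSpace.norm_sq_eq, Complex.ofReal_sum]
  refine Finset.sum_congr rfl fun r _ => ?_
  rw [Complex.star_def, Complex.mul_conj, Complex.normSq_eq_norm_sq]

lemma sum_displacement_mono₁₁ (a c : ZMod d) (w : CSpace d) :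
    ∑ j : ZMod d, ∑ k : ZMod d, evalZ (mono₁₁ a c) ((displacement j k : CSpace d ≃ₗᵢ[ℂ] CSpace d) w) =
      if a = c then d * ((‖w‖ ^ 2 : ℝ) : ℂ) else 0 := by
  have hk : ∀ j, ∑ k : ZMod d, evalZ (mono₁₁ a c) ((displacement j k : CSpace d ≃ₗᵢ[ℂ] CSpace d) w) =
      (if a - c = 0 then (d : ℂ) else 0) * (w (a - j) * star (w (c - j))) := fun j => by
    rw [← sum_stdAddChar_mul, Finset.sum_mul]
    refine Finset.sum_congr rfl fun k _ => ?_
    rw [evalZ_mono₁₁]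
    simp only [displacement_apply, star_mul', star_stdAddChar]
    rw [show k * (a - c) = k * a + -(k * c) by ring]
    simp only [AddChar.map_add_eq_mul]
    ring
  rw [Finset.sum_congr rfl fun j _ => hk j, ← Finset.mul_sum]
  simp only [sub_eq_zero]
  split_ifs with h
  · subst h
    rw [← sum_mul_star_self, ← Equiv.sum_comp (Equiv.subLeft a) (fun r => w r * star (w r))]
    rfl
  · rw [zero_mul]

/-- If the sums of `f` over the displacements of the vectors of an orbit have a common value,
then that value determines the mean of `f` over the orbit. -/
lemma pointMean_orbit_of_sum_displacement (f : ZPoly (ZMod d)) (z : CSpace d) (v : ℂ)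
    (h : ∀ g : weylHeisenberg d,
      ∑ j : ZMod d, ∑ k : ZMod d, evalZ f ((displacement j k : CSpace d ≃ₗᵢ[ℂ] CSpace d) (orbit z g)) = d * v) :
    pointMean (orbit z) f = v / d := by
  have hd : (d : ℂ) ≠ 0 := Nat.cast_ne_zero.2 (NeZero.ne d)
  have hG : (Fintype.card (weylHeisenberg d) : ℂ) ≠ 0 := Nat.cast_ne_zero.2 Fintype.card_ne_zero
  -- Left multiplication by a displacement permutes the group, so an extra average over
  -- displacements changes nothing and the order of the group need not be known.
  have hinv : ∀ j k : ZMod d,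
      ∑ g, evalZ f ((displacement j k : CSpace d ≃ₗᵢ[ℂ] CSpace d) (orbit z g)) =
        ∑ g, evalZ f (orbit z g) := fun j k =>
    Equiv.sum_comp (Equiv.mulLeft (displacement j k)) fun g => evalZ f (orbit z g)
  have hsum : (d : ℂ) * d * ∑ g, evalZ f (orbit z g) =
      Fintype.card (weylHeisenberg d) * (d * v) := by
    calc (d : ℂ) * d * ∑ g, evalZ f (orbit z g)
        = ∑ j : ZMod d, ∑ k : ZMod d, ∑ g,
          evalZ f ((displacement j k : CSpace d ≃ₗᵢ[ℂ] CSpace d) (orbit z g)) := by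
          simp only [hinv, Finset.sum_const, Finset.card_univ, ZMod.card, nsmul_eq_mul, mul_assoc]
      _ = ∑ j : ZMod d, ∑ g, ∑ k : ZMod d,
          evalZ f ((displacement j k : CSpace d ≃ₗᵢ[ℂ] CSpace d) (orbit z g)) :=
          Finset.sum_congr rfl fun j _ => Finset.sum_comm
      _ = ∑ g, ∑ j : ZMod d, ∑ k : ZMod d,
          evalZ f ((displacement j k : CSpace d ≃ₗᵢ[ℂ] CSpace d) (orbit z g)) :=
          Finset.sum_comm
      _ = _ := by
          simp only [h, Finset.sum_const, Finset.card_univ, nsmul_eq_mul]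
  change (1 / (Fintype.card (weylHeisenberg d) : ℂ)) * ∑ g, evalZ f (orbit z g) = v / d
  field_simp
  refine mul_left_cancel₀ hd ?_
  linear_combination hsum

lemma pointMean_orbit_mono₂₂ (a b c e : ZMod d) (z : CSpace d) :
    pointMean (orbit z) (mono₂₂ a b c e) =
      (if a + b = c + e then fST (c - a) (e - a) z else 0) / d := by
  refine pointMean_orbit_of_sum_displacement _ z _ fun g => ?_
  rw [sum_displacement_mono₂₂, orbit, fST_weylHeisenberg]
  split_ifs <;> simp

lemma pointMean_orbit_mono₁₁ (a c : ZMod d) {z : CSpace d} (hz : ‖z‖ = 1) :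
    pointMean (orbit z) (mono₁₁ a c) = 1 / d * if a = c then 1 else 0 := by
  rw [pointMean_orbit_of_sum_displacement (mono₁₁ a c) z (if a = c then 1 else 0) fun g => ?_]
  · ring
  · rw [sum_displacement_mono₁₁, orbit, LinearIsometryEquiv.norm_map, hz]
    split_ifs <;> simp

lemma isTTDesign_orbit_iff {z : CSpace d} (hz : ‖z‖ = 1) :
    IsTTDesign 2 (orbit z) ↔
      (∀ s t : ZMod d, s ≠ 0 → t ≠ 0 → fST s t z = 0) ∧
        ∀ s : ZMod d, s ≠ 0 → fST 0 0 z = 2 * fST s 0 z := by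
  have hd : (d : ℂ) ≠ 0 := Nat.cast_ne_zero.2 (NeZero.ne d)
  rw [isTTDesign_two_iff (orbit z) (fun g => by rw [orbit, LinearIsometryEquiv.norm_map, hz])
    (1 / d) fun a c => pointMean_orbit_mono₁₁ a c hz]
  constructor
  · intro h
    refine ⟨fun s t hs ht => ?_, fun s hs => ?_⟩
    -- Harmonic because `{0, s+t}` is disjoint from `{s, t}`; its orbit mean is `f_{st}(z) / d`.
    · have h1 := h (mono₂₂ 0 (s + t) s t)
        (mono₂₂_mem_harmPoly hs.symm ht.symm (by simpa using ht) (by simpa using hs))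
      simpa [pointMean_orbit_mono₂₂, hd] using h1
    -- The indices are `0` and `s`; the orbit mean is `(2 f_{00} - 4 f_{s0}) / d`.
    · have h1 := h _ (mono₂₂_comb_mem_harmPoly hs.symm)
      simp only [map_add, map_sub, map_smul, pointMean_orbit_mono₂₂, sub_self, sub_zero, add_zero,
        zero_add, if_true, smul_eq_mul] at h1
      field_simp at h1
      linear_combination (1 / 2 : ℂ) * h1
  · rintro ⟨h0, h2⟩ f hf
    -- The constant is forced by the moment with `a = b = c = e`, which has both pairings and equals
    -- `f_{00} / d`.
    refine harmPoly_two_eq_zero _ (fST 0 0 z / (2 * d)) (fun a b c e => ?_) hf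
    rw [pointMean_orbit_mono₂₂]
    by_cases hac : a = c
    · subst hac
      simp only [add_right_inj, sub_self, if_true]
      by_cases hbe : b = e
      · subst hbe
        by_cases hab : a = b
        · subst hab
          simp only [sub_self, if_true]
          field_simp
          ring
        · simp only [if_true, hab, if_false, fST_comm 0, h2 _ (sub_ne_zero.2 (Ne.symm hab))]
          field_simp
          ring
      · have : ¬ (a = e ∧ b = a) := fun h => hbe (h.2.trans h.1)
        by_cases hae : a = e <;> simp_all
    · by_cases hae : a = e
      · subst hae
        by_cases hbc : b = c
        · subst hbc
          simp only [add_comm a b, sub_self, if_true, hac, if_false,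
            h2 _ (sub_ne_zero.2 (Ne.symm hac))]
          field_simp
          ring
        · have : ¬ (a + b = c + a) := fun h => hbc (by linear_combination h)
          simp [hac, hbc, this]
      · rw [h0 _ _ (sub_ne_zero.2 (Ne.symm hac)) (sub_ne_zero.2 (Ne.symm hae))]
        simp [hac, hae]

end Displacement

/-! ### Overlaps, their Fourier transform, and SICs. -/

section SIC

variable {d : ℕ} [NeZero d]

/-- The inner product of `z` with its displacement by `(j, k)`. -/
noncomputable def overlap (z : CSpace d) (p : ZMod d × ZMod d) : ℂ :=
  inner ℂ z ((displacement p.1 p.2 : CSpace d ≃ₗᵢ[ℂ] CSpace d) z)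

lemma overlap_eq_sum (z : CSpace d) (p : ZMod d × ZMod d) :
    overlap z p = ∑ i, star (z i) * (ZMod.stdAddChar (p.2 * i) * z (i - p.1)) := by
  rw [overlap, PiLp.inner_apply]
  refine Finset.sum_congr rfl fun i _ => ?_
  rw [displacement_apply, RCLike.inner_apply, mul_comm]
  rfl

/-- Expand the square as a double sum over `r` and `r + s`: the phase depends on `s` alone, and the
sum over `r` of what remains is `f_{s,-j}`. -/
lemma normSq_overlap (z : CSpace d) (p : ZMod d × ZMod d) :
    ((‖overlap z p‖ ^ 2 : ℝ) : ℂ) = ZMod.dft (fun s => fST s (-p.1) z) (-p.2) := by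
  have h1 : ((‖overlap z p‖ ^ 2 : ℝ) : ℂ) = overlap z p * star (overlap z p) := by
    rw [Complex.star_def, Complex.mul_conj, Complex.normSq_eq_norm_sq]
  rw [h1, overlap_eq_sum, star_sum, Finset.mul_sum, ZMod.dft_apply]
  simp only [smul_eq_mul, fST, Finset.mul_sum]
  rw [Finset.sum_comm]
  refine Finset.sum_congr rfl fun r _ => ?_
  rw [Finset.sum_mul, ← Equiv.sum_comp (Equiv.addLeft r)]
  refine Finset.sum_congr rfl fun s _ => ?_
  simp only [Equiv.coe_addLeft, star_mul', star_star, star_stdAddChar]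
  rw [show -(s * -p.2) = p.2 * (r + s) + -(p.2 * r) by ring, AddChar.map_add_eq_mul,
    ← sub_eq_add_neg, ← sub_eq_add_neg]
  ring

lemma overlap_zero {z : CSpace d} (hz : ‖z‖ = 1) : overlap z 0 = 1 := by
  have h : (displacement (0 : ZMod d) 0 : CSpace d ≃ₗᵢ[ℂ] CSpace d) z = z := by
    ext i; simp [displacement_apply]
  rw [overlap, Prod.fst_zero, Prod.snd_zero, h, inner_self_eq_norm_sq_to_K, hz]
  simp

/-- `f_{s0} = ∑_r |z_r|² |z_{r+s}|²`, so the sum over `s` factors as `‖z‖⁴`. -/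
lemma sum_fST_zero {z : CSpace d} (hz : ‖z‖ = 1) : ∑ s, fST s 0 z = 1 := by
  have h : ∑ s, fST s 0 z = (∑ r, z r * star (z r)) * ∑ r, z r * star (z r) := by
    unfold fST
    rw [Finset.sum_comm, Finset.sum_mul]
    refine Finset.sum_congr rfl fun r _ => ?_
    rw [← Equiv.sum_comp (Equiv.addLeft r) (fun r => z r * star (z r)), Finset.mul_sum]
    refine Finset.sum_congr rfl fun s _ => ?_
    simp only [Equiv.coe_addLeft, add_zero]
    ring
  rw [h, sum_mul_star_self, hz]
  simp

/-- Summing the Fourier transforms over `k` isolates `s = 0` and leaves `d ∑_j f_{0,-j} = d`. This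
pins down the common overlap of an equiangular orbit. -/
lemma sum_normSq_overlap {z : CSpace d} (hz : ‖z‖ = 1) : ∑ p, ‖overlap z p‖ ^ 2 = (d : ℝ) := by
  apply Complex.ofReal_injective
  rw [Complex.ofReal_sum]
  simp only [normSq_overlap, Fintype.sum_prod_type, ZMod.dft_apply, smul_eq_mul]
  have hj : ∀ j : ZMod d, ∑ k : ZMod d, ∑ s, (ZMod.stdAddChar (-(s * -k)) : ℂ) * fST s (-j) z =
      d * fST (-j) 0 z := fun j => by
    rw [Finset.sum_comm, Finset.sum_eq_single 0]
    · simp [fST_comm (-j)]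
    · intro s _ hs
      rw [← Finset.sum_mul]
      have h := sum_stdAddChar_mul s
      rw [if_neg hs] at h
      rw [show ∑ k : ZMod d, (ZMod.stdAddChar (-(s * -k)) : ℂ) = 0 from
        (Finset.sum_congr rfl fun k _ => by congr 1; ring).trans h, zero_mul]
    · simp
  rw [Finset.sum_congr rfl fun j _ => hj j, ← Finset.mul_sum,
    show ∑ j, fST (-j) 0 z = ∑ s, fST s 0 z from
      Equiv.sum_comp (Equiv.neg (ZMod d)) (fun s => fST s 0 z), sum_fST_zero hz]
  simp

/-- The transform exchanges the point mass at 0 and the constant function, the latter becoming `d`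
times a point mass. -/
lemma dft_sicValues (t k : ZMod d) :
    ZMod.dft (fun s : ZMod d =>
      ((if s = 0 then (1 : ℂ) else 0) + (if t = 0 then 1 else 0)) / ((d : ℂ) + 1)) k =
      (1 + if t = 0 ∧ k = 0 then (d : ℂ) else 0) / ((d : ℂ) + 1) := by
  have hs : ∑ s : ZMod d, (ZMod.stdAddChar (-(s * k)) : ℂ) = if k = 0 then (d : ℂ) else 0 := by
    have h := sum_stdAddChar_mul (-k)
    simpa using h
  rw [ZMod.dft_apply]
  simp only [smul_eq_mul, mul_div_assoc', mul_add, ← Finset.sum_div, Finset.sum_add_distrib,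
    ← Finset.sum_mul, hs]
  congr 2
  · simp
  · split_ifs <;> simp_all

/-- The standard SIC equations say that all overlaps have modulus `1 / √(d + 1)`. -/
lemma overlaps_iff {z : CSpace d} (hz : ‖z‖ = 1) :
    (∀ p : ZMod d × ZMod d, p ≠ 0 → ‖overlap z p‖ ^ 2 = 1 / ((d : ℝ) + 1)) ↔
      (∀ s t : ZMod d, s ≠ 0 → t ≠ 0 → fST s t z = 0) ∧
      (∀ s : ZMod d, s ≠ 0 → fST s 0 z = 1 / ((d : ℂ) + 1)) ∧
      fST 0 0 z = 2 / ((d : ℂ) + 1) := by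
  have hd : (d : ℂ) + 1 ≠ 0 := Nat.cast_add_one_ne_zero d
  have hval : ((∀ s t : ZMod d, s ≠ 0 → t ≠ 0 → fST s t z = 0) ∧
      (∀ s : ZMod d, s ≠ 0 → fST s 0 z = 1 / ((d : ℂ) + 1)) ∧
      fST 0 0 z = 2 / ((d : ℂ) + 1)) ↔ ∀ t, (fun s => fST s t z) = fun s : ZMod d =>
        ((if s = 0 then (1 : ℂ) else 0) + (if t = 0 then 1 else 0)) / ((d : ℂ) + 1) := by
    constructor
    · rintro ⟨h1, h2, h3⟩ t
      ext s
      by_cases hs : s = 0 <;> by_cases ht : t = 0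
      · subst hs ht
        rw [h3]; norm_num
      · subst hs
        rw [fST_comm, h2 t ht]; simp [ht]
      · subst ht
        rw [h2 s hs]; simp [hs]
      · rw [h1 s t hs ht]; simp [hs, ht]
    · intro h
      refine ⟨fun s t hs ht => ?_, fun s hs => ?_, ?_⟩
      · simpa [hs, ht] using congrFun (h t) s
      · simpa [hs] using congrFun (h 0) s
      · rw [congrFun (h 0) 0]; norm_num
  rw [hval]
  constructor
  · intro h t
    apply ZMod.dft.injective
    ext k
    rw [dft_sicValues]
    have hp := normSq_overlap z (-t, -k)
    rw [neg_neg, neg_neg] at hp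
    rw [← hp]
    -- The trivial overlap is not covered by the hypothesis; it is `1 = (1 + d)/(d + 1)` because `z`
    -- is a unit vector.
    by_cases htk : t = 0 ∧ k = 0
    · obtain ⟨rfl, rfl⟩ := htk
      rw [neg_zero, Prod.mk_zero_zero, overlap_zero hz]
      simp only [and_self, if_true, norm_one, one_pow, Complex.ofReal_one]
      field_simp
      ring
    · rw [h _ (by simpa [Prod.ext_iff] using htk), if_neg htk]
      push_cast
      ring
  · intro h p hp
    apply Complex.ofReal_injective
    rw [normSq_overlap, h, dft_sicValues, if_neg (by simpa [Prod.ext_iff] using hp)]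
    push_cast
    ring

/-- Displacements compose additively up to a phase, so the modulus depends only on the difference of
the labels. -/
lemma norm_inner_displacement (z : CSpace d) (p q : ZMod d × ZMod d) :
    ‖inner ℂ ((displacement p.1 p.2 : CSpace d ≃ₗᵢ[ℂ] CSpace d) z)
      ((displacement q.1 q.2 : CSpace d ≃ₗᵢ[ℂ] CSpace d) z)‖ = ‖overlap z (q - p)‖ := by
  have h : (displacement q.1 q.2 : CSpace d ≃ₗᵢ[ℂ] CSpace d) z =
      (ZMod.stdAddChar ((q.2 - p.2) * p.1) : ℂ) •
        (displacement p.1 p.2 : CSpace d ≃ₗᵢ[ℂ] CSpace d)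
          ((displacement (q - p).1 (q - p).2 : CSpace d ≃ₗᵢ[ℂ] CSpace d) z) := by
    ext i
    simp only [displacement_apply, PiLp.smul_apply, smul_eq_mul, ← mul_assoc,
      ← AddChar.map_add_eq_mul, Prod.fst_sub, Prod.snd_sub]
    rw [show i - p.1 - (q.1 - p.1) = i - q.1 by ring,
      show (q.2 - p.2) * p.1 + (p.2 * i + (q.2 - p.2) * (i - p.1)) = q.2 * i by ring]
  rw [h, inner_smul_right, norm_mul, LinearIsometryEquiv.inner_map_map, overlap,
    ZMod.stdAddChar_apply, Circle.norm_coe, one_mul]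

/-- The line spanned by a displacement of `z`. -/
noncomputable def displacedLine (z : CSpace d) (p : ZMod d × ZMod d) : Submodule ℂ (CSpace d) :=
  Submodule.span ℂ {(displacement p.1 p.2 : CSpace d ≃ₗᵢ[ℂ] CSpace d) z}

/-- Each group element is a displacement times a scalar phase, which does not change the line. -/
lemma orbitLines_eq_range (z : CSpace d) : orbitLines z = Set.range (displacedLine z) := by
  ext ℓ
  constructor
  · rintro ⟨g, rfl⟩
    obtain ⟨l, j, k, h⟩ := exists_of_mem_weylHeisenberg d g.2
    refine ⟨(j, k), ?_⟩
    have hg : orbit z g = (ZMod.stdAddChar l : ℂ) •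
        (displacement j k : CSpace d ≃ₗᵢ[ℂ] CSpace d) z := by
      ext i
      rw [orbit, h, PiLp.smul_apply, displacement_apply, smul_eq_mul, ← mul_assoc,
        ← AddChar.map_add_eq_mul]
    have hu : IsUnit (ZMod.stdAddChar l : ℂ) := by
      rw [isUnit_iff_ne_zero, ZMod.stdAddChar_apply]
      exact Circle.coe_ne_zero _
    change displacedLine z (j, k) = Submodule.span ℂ {orbit z g}
    rw [hg, Submodule.span_singleton_smul_eq hu]
    rfl
  · rintro ⟨p, rfl⟩
    exact ⟨displacement p.1 p.2, rfl⟩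

lemma norm_inner_of_mem_displacedLine {z : CSpace d} (hz : ‖z‖ = 1) {p q : ZMod d × ZMod d}
    {u v : CSpace d} (hu : u ∈ displacedLine z p) (hv : v ∈ displacedLine z q) (hu1 : ‖u‖ = 1)
    (hv1 : ‖v‖ = 1) : ‖inner ℂ u v‖ = ‖overlap z (q - p)‖ := by
  obtain ⟨α, rfl⟩ := Submodule.mem_span_singleton.1 hu
  obtain ⟨β, rfl⟩ := Submodule.mem_span_singleton.1 hv
  rw [norm_smul, LinearIsometryEquiv.norm_map, hz, mul_one] at hu1 hv1
  rw [inner_smul_left, inner_smul_right, norm_mul, norm_mul, norm_inner_displacement,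
    RCLike.norm_conj, hu1, hv1, one_mul, one_mul]

lemma mem_displacedLine (z : CSpace d) (p : ZMod d × ZMod d) :
    (displacement p.1 p.2 : CSpace d ≃ₗᵢ[ℂ] CSpace d) z ∈ displacedLine z p :=
  Submodule.mem_span_singleton_self _

lemma ncard_orbitLines_iff (z : CSpace d) :
    (orbitLines z).ncard = d ^ 2 ↔ Function.Injective (displacedLine z) := by
  classical
  have hcard : (Finset.univ : Finset (ZMod d × ZMod d)).card = d ^ 2 := by
    rw [Finset.card_univ, Fintype.card_prod, ZMod.card, sq]
  rw [orbitLines_eq_range, ← Set.image_univ, ← Finset.coe_univ, ← Finset.coe_image,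
    Set.ncard_coe_finset, ← hcard, Finset.card_image_iff, Finset.coe_univ, Set.injOn_univ]

/-- A common value `c²` satisfies `1 + (d² - 1) c² = d`, so `c² = 1/(d+1)`. Conversely, overlaps of
modulus below 1 keep the `d²` lines distinct. -/
lemma isWeylHeisenbergSIC_iff (hd : 2 ≤ d) {z : CSpace d} (hz : ‖z‖ = 1) :
    IsWeylHeisenbergSIC z ↔
      ∀ p : ZMod d × ZMod d, p ≠ 0 → ‖overlap z p‖ ^ 2 = 1 / ((d : ℝ) + 1) := by
  have hd2 : (2 : ℝ) ≤ d := by exact_mod_cast hd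
  have hunit : ∀ p : ZMod d × ZMod d,
      ‖(displacement p.1 p.2 : CSpace d ≃ₗᵢ[ℂ] CSpace d) z‖ = 1 := fun p => by
    rw [LinearIsometryEquiv.norm_map, hz]
  rw [IsWeylHeisenbergSIC, ncard_orbitLines_iff, orbitLines_eq_range]
  constructor
  · rintro ⟨hinj, c, hc⟩
    have hov : ∀ p : ZMod d × ZMod d, p ≠ 0 → ‖overlap z p‖ ^ 2 = c ^ 2 := fun p hp => by
      rw [← hc _ ⟨0, rfl⟩ _ ⟨p, rfl⟩ (fun h => hp (hinj h).symm) _ (mem_displacedLine z 0) _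
        (mem_displacedLine z p) (hunit 0) (hunit p), norm_inner_displacement, sub_zero]
    have hsum := sum_normSq_overlap hz
    rw [← Finset.add_sum_erase _ _ (Finset.mem_univ (0 : ZMod d × ZMod d)), overlap_zero hz,
      Finset.sum_congr rfl fun p hp => hov p (Finset.ne_of_mem_erase hp), Finset.sum_const,
      Finset.card_erase_of_mem (Finset.mem_univ _), Finset.card_univ, Fintype.card_prod,
      ZMod.card, nsmul_eq_mul, Nat.cast_sub (by nlinarith)] at hsum
    push_cast at hsum
    intro p hp
    rw [hov p hp, eq_div_iff (by positivity)]
    -- Here `d ≥ 2` is needed: for `d = 1` there is only one line and `c` is unconstrained.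
    refine mul_left_cancel₀ (show (d : ℝ) - 1 ≠ 0 by linarith) ?_
    rw [norm_one] at hsum
    linear_combination hsum
  · intro h
    refine ⟨fun p q hpq => ?_, √(1 / ((d : ℝ) + 1)), ?_⟩
    · by_contra hne
      -- If two lines coincide, the same unit vector lies in both, so their overlap would have
      -- modulus 1.
      have h1 := norm_inner_of_mem_displacedLine hz (mem_displacedLine z p)
        (hpq ▸ mem_displacedLine z p) (hunit p) (hunit p)
      have h2 := h _ (sub_ne_zero.2 (Ne.symm hne))
      rw [← h1, inner_self_eq_norm_sq_to_K, hunit] at h2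
      simp at h2
      omega
    · rintro _ ⟨p, rfl⟩ _ ⟨q, rfl⟩ hne u hu v hv hu1 hv1
      have hpq : p ≠ q := fun h => hne (h ▸ rfl)
      rw [norm_inner_of_mem_displacedLine hz hu hv hu1 hv1,
        ← h _ (sub_ne_zero.2 hpq.symm), Real.sqrt_sq (norm_nonneg _)]

/-- Substituting `f_{s0} = f_{00}/2` into `∑_s f_{s0} = 1` gives `f_{00} (1 + (d-1)/2) = 1`. -/
lemma sicEquations_iff {z : CSpace d} (hz : ‖z‖ = 1) :
    ((∀ s t : ZMod d, s ≠ 0 → t ≠ 0 → fST s t z = 0) ∧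
      (∀ s : ZMod d, s ≠ 0 → fST 0 0 z = 2 * fST s 0 z)) ↔
      (∀ s t : ZMod d, s ≠ 0 → t ≠ 0 → fST s t z = 0) ∧
      (∀ s : ZMod d, s ≠ 0 → fST s 0 z = 1 / ((d : ℂ) + 1)) ∧
      fST 0 0 z = 2 / ((d : ℂ) + 1) := by
  have hd1 : (d : ℂ) + 1 ≠ 0 := Nat.cast_add_one_ne_zero d
  refine and_congr_right fun _ => ⟨fun h => ?_, ?_⟩
  · have hsum := sum_fST_zero hz
    rw [← Finset.add_sum_erase _ _ (Finset.mem_univ (0 : ZMod d)),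
      Finset.sum_congr rfl fun s hs => show fST s 0 z = fST 0 0 z / 2 by
        rw [h s (Finset.ne_of_mem_erase hs)]; ring,
      Finset.sum_const, Finset.card_erase_of_mem (Finset.mem_univ _), Finset.card_univ,
      ZMod.card, nsmul_eq_mul, Nat.cast_sub (NeZero.one_le), Nat.cast_one] at hsum
    have h00 : fST 0 0 z = 2 / ((d : ℂ) + 1) := by
      rw [eq_div_iff hd1]
      linear_combination 2 * hsum
    refine ⟨fun s hs => ?_, h00⟩
    have := h s hs
    rw [h00] at this
    linear_combination (-1 / 2 : ℂ) * this
  · rintro ⟨h1, h0⟩ s hs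
    rw [h0, h1 s hs]
    ring

end SIC

end WHDesign

theorem mainTheorem9 (d : ℕ) [NeZero d] (hd : 2 ≤ d) (z : WHDesign.CSpace d) (hz : ‖z‖ = 1) :
    -- the orbit is a SIC if and only if it is a spherical (2,2)-design
    (WHDesign.IsWeylHeisenbergSIC z ↔ WHDesign.IsTTDesign 2 (WHDesign.orbit z)) ∧
    -- the orbit is a spherical (2,2)-design if and only if the homogeneous equations hold
    (WHDesign.IsTTDesign 2 (WHDesign.orbit z) ↔
      (∀ s t : ZMod d, s ≠ 0 → t ≠ 0 → WHDesign.fST s t z = 0) ∧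
      (∀ s : ZMod d, s ≠ 0 → WHDesign.fST 0 0 z = 2 * WHDesign.fST s 0 z)) ∧
    -- the homogeneous equations are equivalent to the standard SIC equations
    (((∀ s t : ZMod d, s ≠ 0 → t ≠ 0 → WHDesign.fST s t z = 0) ∧
      (∀ s : ZMod d, s ≠ 0 → WHDesign.fST 0 0 z = 2 * WHDesign.fST s 0 z)) ↔
      (∀ s t : ZMod d, s ≠ 0 → t ≠ 0 → WHDesign.fST s t z = 0) ∧
      (∀ s : ZMod d, s ≠ 0 → WHDesign.fST s 0 z = 1 / ((d : ℂ) + 1)) ∧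
      WHDesign.fST 0 0 z = 2 / ((d : ℂ) + 1)) := by
  have h2 := WHDesign.isTTDesign_orbit_iff hz
  have h3 := WHDesign.sicEquations_iff hz
  exact ⟨(WHDesign.isWeylHeisenbergSIC_iff hd hz).trans
    ((WHDesign.overlaps_iff hz).trans (h2.trans h3).symm), h2, h3⟩
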